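/- Let $K$ be a field of characteristic zero and let $1\le n\le 5$. Let $K_n$ be the complete graph on $n$ vertices, with $N=\binom n2$ edges, assign a variable $x_e$ to each edge $e$, and let $$F_{K_n}=\sum_{T}\prod_{e\in E(T)}x_e ,$$ where $T$ runs over the spanning trees of $K_n$. Let $\operatorname{Ann}(F_{K_n})$ be the ideal of all $P\in K[x_1,\dots,x_N]$ with $P(\partial/\partial x_1,\dots,\partial/\partial x_N)F_{K_n}=0$, and let $A=A_{M(K_n)}=K[x_1,\dots,x_N]/\operatorname{Ann}(F_{K_n})$, with $A_k$ the image in $A$ of the homogeneous polynomials of degree $k$. Then $A$ is an Artinian Gorenstein algebra, graded as $A=\bigoplus_{k=0}^{s}A_k$ with $A_s\ne 0$, where $s=n-1$, and $A$ has the strong Lefschetz property: there is an element $L\in A_1$ such that the multiplication map $\times L^{s-2k}\colon A_k\to A_{s-k}$ is bijective for all integers $0\le k\le s/2$. Moreover, the element $L=x_1+\cdots+x_N$ is such a strong Lefschetz element. -/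

import Mathlib

/-- Two partial derivatives of a polynomial commute. -/
theorem pderiv_lin_comm {σ K : Type*} [Field K] (i j : σ) :
    (MvPolynomial.pderiv (R := K) i).toLinearMap * (MvPolynomial.pderiv j).toLinearMap =
      ((MvPolynomial.pderiv j).toLinearMap * (MvPolynomial.pderiv i).toLinearMap :
        Module.End K (MvPolynomial σ K)) := by
  classical
  have h : ⁅MvPolynomial.pderiv (R := K) i, MvPolynomial.pderiv (R := K) j⁆ = 0 := by
    apply MvPolynomial.derivation_ext
    intro k
    simp only [Derivation.commutator_apply, MvPolynomial.pderiv_X, Pi.single_apply]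
    split_ifs <;> simp
  refine LinearMap.ext fun p => ?_
  have hp := congrArg (fun D => D p) h
  simp only [Derivation.commutator_apply, Derivation.coe_zero, Pi.zero_apply,
    sub_eq_zero] at hp
  exact hp

open scoped IsMulCommutative in
/-- The algebra homomorphism `P ↦ P(∂/∂x)` from polynomials to differential operators
with constant coefficients; it sends the variable `x i` to `∂/∂x i` (see `diffOp_X`). -/
noncomputable def diffOp (σ K : Type*) [Field K] :
    MvPolynomial σ K →ₐ[K] Module.End K (MvPolynomial σ K) :=
  haveI : IsMulCommutative (Algebra.adjoin K (Set.range fun i : σ =>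
      ((MvPolynomial.pderiv i).toLinearMap : Module.End K (MvPolynomial σ K)))) :=
    Algebra.isMulCommutative_adjoin K (by
      rintro _ ⟨i, rfl⟩ _ ⟨j, rfl⟩
      exact pderiv_lin_comm i j)
  (Algebra.adjoin K (Set.range fun i : σ =>
      ((MvPolynomial.pderiv i).toLinearMap : Module.End K (MvPolynomial σ K)))).val.comp
    (MvPolynomial.aeval fun i : σ =>
      (⟨(MvPolynomial.pderiv i).toLinearMap, Algebra.subset_adjoin ⟨i, rfl⟩⟩ :
        Algebra.adjoin K (Set.range fun i : σ =>
          ((MvPolynomial.pderiv i).toLinearMap : Module.End K (MvPolynomial σ K)))))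

theorem diffOp_X {σ K : Type*} [Field K] (i : σ) :
    diffOp σ K (MvPolynomial.X i) = (MvPolynomial.pderiv i).toLinearMap := by
  simp [diffOp]

/-- `Ann(F)`: the ideal of all polynomials `P` with `P(∂/∂x) F = 0`. -/
noncomputable def diffAnn {σ K : Type*} [Field K] (F : MvPolynomial σ K) :
    Ideal (MvPolynomial σ K) where
  carrier := {P | diffOp σ K P F = 0}
  add_mem' := by
    intro P Q hP hQ
    simp only [Set.mem_ofPred_eq] at hP hQ ⊢
    rw [map_add, LinearMap.add_apply, hP, hQ, add_zero]
  zero_mem' := by simp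
  smul_mem' := by
    intro P Q hQ
    simp only [Set.mem_ofPred_eq] at hQ ⊢
    rw [smul_eq_mul, map_mul, Module.End.mul_apply, hQ, map_zero]

/-- The degree `k` part of a quotient of a polynomial ring: the image of the space of
homogeneous polynomials of degree `k`. -/
noncomputable def quotientGrading {σ K : Type*} [Field K] (I : Ideal (MvPolynomial σ K))
    (k : ℕ) : Submodule K (MvPolynomial σ K ⧸ I) :=
  (MvPolynomial.homogeneousSubmodule σ K k).map (Ideal.Quotient.mkₐ K I).toLinearMap

/-- A set `T` of edges of `G` is (the edge set of) a spanning tree of `G`: the graph with all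
the vertices of `G` and with edge set `T` is a tree. -/
def IsSpanningTree {V : Type*} (G : SimpleGraph V) (T : Finset G.edgeSet) : Prop :=
  (SimpleGraph.fromEdgeSet (Subtype.val '' (T : Set G.edgeSet))).IsTree

open Classical in
/-- The Kirchhoff polynomial `F_G = ∑_T ∏_{e ∈ T} x_e`, summed over the spanning trees `T`. -/
noncomputable def kirchhoffPolynomial {V : Type*} [Fintype V] (K : Type*) [Field K]
    (G : SimpleGraph V) : MvPolynomial G.edgeSet K :=
  ∑ T : Finset G.edgeSet with IsSpanningTree G T, ∏ e ∈ T, MvPolynomial.X e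

/-- The algebra `A_{M(G)} = K[x_e : e ∈ E(G)] / Ann(F_G)`. -/
abbrev GraphicAlgebra {V : Type*} [Fintype V] (K : Type*) [Field K] (G : SimpleGraph V) :
    Type _ :=
  MvPolynomial G.edgeSet K ⧸ diffAnn (kirchhoffPolynomial K G)

/-- The grading of `A_{M(G)}` by degree. -/
noncomputable abbrev graphicGrading {V : Type*} [Fintype V] (K : Type*) [Field K]
    (G : SimpleGraph V) : ℕ → Submodule K (GraphicAlgebra K G) :=
  quotientGrading (diffAnn (kirchhoffPolynomial K G))

open Classical in
/-- The class of `∑_e x_e` in `A_{M(G)}`. -/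
noncomputable def edgeSum {V : Type*} [Fintype V] (K : Type*) [Field K]
    (G : SimpleGraph V) : GraphicAlgebra K G :=
  Ideal.Quotient.mk _ (∑ e : G.edgeSet, MvPolynomial.X e)

/-- A (local) Artinian Gorenstein ring: an Artinian local ring whose socle, the annihilator of
the maximal ideal, is a simple module. -/
structure IsArtinianGorenstein (A : Type*) [CommRing A] : Prop
    extends IsArtinianRing A, IsLocalRing A where
  isSimple_socle : IsSimpleModule A (IsLocalRing.maximalIdeal A).annihilator

/-- `A = ⨁_{k=0}^s A_k` is a graded Artinian algebra with `A_s ≠ 0`. -/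
structure IsGradedArtinian {K A : Type*} [Field K] [CommRing A] [Algebra K A]
    (𝒜 : ℕ → Submodule K A) (s : ℕ) : Prop where
  artinian : IsArtinianRing A
  graded : SetLike.GradedMonoid 𝒜
  internal : DirectSum.IsInternal 𝒜
  top_ne : 𝒜 s ≠ ⊥
  eq_bot : ∀ k, s < k → 𝒜 k = ⊥

/-- `L` is a strong Lefschetz element of `A = ⨁_{k=0}^s A_k`: it lies in `A_1`, and
multiplication by `L ^ (s - 2k)` is a bijection `A_k → A_{s-k}` whenever `k ≤ s / 2`. -/
structure IsStrongLefschetzElement {K A : Type*} [Field K] [CommRing A] [Algebra K A]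
    (𝒜 : ℕ → Submodule K A) (s : ℕ) (L : A) : Prop where
  mem : L ∈ 𝒜 1
  bij : ∀ k, 2 * k ≤ s →
    Set.BijOn (fun a => L ^ (s - 2 * k) * a) (𝒜 k : Set A) (𝒜 (s - k) : Set A)

/-- The strong Lefschetz property of a graded Artinian algebra `A = ⨁_{k=0}^s A_k`, `A_s ≠ 0`
(the number `s` is determined by the grading). -/
def HasStrongLefschetzProperty {K A : Type*} [Field K] [CommRing A] [Algebra K A]
    (𝒜 : ℕ → Submodule K A) : Prop :=
  ∃ s, IsGradedArtinian 𝒜 s ∧ ∃ L, IsStrongLefschetzElement 𝒜 s L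

/-! Write F = F_{K_n}, a form of degree s = n - 1. The map P ↦ P(∂)F embeds A into K[x]
(`apolarMap`) and carries A_k into forms of degree s - k. This yields the grading, and the socle is
one-dimensional because its elements map to constants. The pairing (a, b) ↦ (ab)(∂)F makes A_k and
A_{s-k} dual, so bijectivity of × L^{s-2k} reduces to injectivity (`bijOn_mul_of_injective`).

As n ≤ 5 forces s ≤ 4, only k = 0 and k = 1 can satisfy 2k < s. Since (∑ ∂_e)^d G = d! G(1,…,1) for
a form G of degree d (`eval_one_diffOp_sum_X_pow`), it suffices that F(1,…,1) ≠ 0 and, for s ≥ 3,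
that the Hessian of F at (1,…,1) is invertible (`isStrongLefschetzElement_sum_X`). The value
F(1,…,1) counts spanning trees. The Hessian has zero diagonal, and its other entries count the trees
through two edges e, f; by symmetry such a count depends only on whether e and f meet. For n = 4, 5
an explicit integer matrix inverts the Hessian up to a scalar. -/

open MvPolynomial

/-! ### Constant-coefficient differential operators acting on forms. -/

section Apolarity

variable {σ K : Type*} [Field K]

theorem diffOp_X_mul_apply (i : σ) (P G : MvPolynomial σ K) :
    diffOp σ K (X i * P) G = pderiv i (diffOp σ K P G) := by
  rw [map_mul, Module.End.mul_apply, diffOp_X]; rfl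

theorem diffOp_mul_apply (P Q G : MvPolynomial σ K) :
    diffOp σ K (P * Q) G = diffOp σ K P (diffOp σ K Q G) := by
  rw [map_mul, Module.End.mul_apply]

theorem diffOp_C_apply (c : K) (G : MvPolynomial σ K) : diffOp σ K (C c) G = c • G := by
  rw [← algebraMap_eq, AlgHom.commutes, Module.algebraMap_end_apply]

theorem mem_diffAnn {F P : MvPolynomial σ K} : P ∈ diffAnn F ↔ diffOp σ K P F = 0 := Iff.rfl

/-- Induction peels one variable off the monomial. The second clause is needed because `d - n`
truncates to 0 when `d < n`. -/
theorem diffOp_monomial_isHomogeneous (n : ℕ) :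
    ∀ (b : σ →₀ ℕ), b.degree = n → ∀ (G : MvPolynomial σ K) (d : ℕ), G.IsHomogeneous d →
      (diffOp σ K (monomial b 1) G).IsHomogeneous (d - n) ∧
        (d < n → diffOp σ K (monomial b 1) G = 0) := by
  classical
  induction n with
  | zero =>
    intro b hb G d hG
    obtain rfl : b = 0 := (Finsupp.degree_eq_zero_iff b).1 hb
    rw [show monomial (0 : σ →₀ ℕ) (1 : K) = 1 from rfl, map_one]
    exact ⟨hG, fun h => absurd h (Nat.not_lt_zero _)⟩
  | succ n ih =>
    intro b hb G d hG
    obtain ⟨i, hi⟩ : ∃ i, b i ≠ 0 := by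
      by_contra! h
      have : b = 0 := Finsupp.ext h
      simp [this] at hb
    have hle : Finsupp.single i 1 ≤ b := by
      rw [Finsupp.single_le_iff]; omega
    have hb' : Finsupp.single i 1 + (b - Finsupp.single i 1) = b := add_tsub_cancel_of_le hle
    have hdeg : (b - Finsupp.single i 1).degree = n := by
      have := congrArg Finsupp.degree hb'
      rw [map_add, Finsupp.degree_single, hb] at this
      omega
    have hm : monomial b (1 : K) = X i * monomial (b - Finsupp.single i 1) 1 := by
      rw [X, monomial_mul, hb', one_mul]
    obtain ⟨h1, h2⟩ := ih _ hdeg G d hG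
    rw [hm, diffOp_X_mul_apply]
    refine ⟨by simpa [Nat.sub_sub] using h1.pderiv (i := i), fun hd => ?_⟩
    rcases Nat.lt_or_ge d n with h | h
    · rw [h2 h, map_zero]
    -- Here d = n, so the last derivative falls on a constant.
    · have : d - n = 0 := by omega
      rw [this, ← totalDegree_zero_iff_isHomogeneous, totalDegree_eq_zero_iff_eq_C] at h1
      rw [h1, pderiv_C]

theorem diffOp_eq_sum (P G : MvPolynomial σ K) :
    diffOp σ K P G = ∑ b ∈ P.support, coeff b P • diffOp σ K (monomial b 1) G := by
  conv_lhs => rw [P.as_sum, map_sum, LinearMap.sum_apply]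
  refine Finset.sum_congr rfl fun b _ => ?_
  rw [← LinearMap.smul_apply, ← map_smul, smul_monomial, smul_eq_mul, mul_one]

/-- A differential operator of order `k` lowers the degree by `k`. -/
theorem MvPolynomial.IsHomogeneous.diffOp {P G : MvPolynomial σ K} {k d : ℕ}
    (hP : P.IsHomogeneous k) (hG : G.IsHomogeneous d) :
    (diffOp σ K P G).IsHomogeneous (d - k) := by
  rw [diffOp_eq_sum]
  refine IsHomogeneous.sum _ _ _ fun b hb => ?_
  rw [smul_eq_C_mul]
  have hb' : b.degree = k := by
    by_contra h; exact (mem_support_iff.1 hb) (hP.coeff_eq_zero h)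
  exact ((diffOp_monomial_isHomogeneous k b hb' G d hG).1).C_mul _

theorem MvPolynomial.IsHomogeneous.diffOp_eq_zero {P G : MvPolynomial σ K} {k d : ℕ}
    (hP : P.IsHomogeneous k) (hG : G.IsHomogeneous d) (hdk : d < k) :
    _root_.diffOp σ K P G = 0 := by
  rw [diffOp_eq_sum]
  refine Finset.sum_eq_zero fun b hb => ?_
  have hb' : b.degree = k := by
    by_contra h; exact (mem_support_iff.1 hb) (hP.coeff_eq_zero h)
  rw [(diffOp_monomial_isHomogeneous k b hb' G d hG).2 hdk, smul_zero]

theorem diffOp_eq_sum_homogeneousComponent (P G : MvPolynomial σ K) :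
    diffOp σ K P G =
      ∑ i ∈ Finset.range (P.totalDegree + 1), diffOp σ K (homogeneousComponent i P) G := by
  conv_lhs => rw [← sum_homogeneousComponent P, map_sum, LinearMap.sum_apply]

/-- The homogeneous components of `P(∂/∂x) G` for `G` homogeneous. -/
theorem homogeneousComponent_diffOp {G : MvPolynomial σ K} {d : ℕ} (hG : G.IsHomogeneous d)
    (P : MvPolynomial σ K) {k : ℕ} (hk : k ≤ d) :
    homogeneousComponent (d - k) (diffOp σ K P G) = diffOp σ K (homogeneousComponent k P) G := by
  rw [diffOp_eq_sum_homogeneousComponent, map_sum]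
  rw [Finset.sum_eq_single k]
  · exact homogeneousComponent_eq_self ((homogeneousComponent_isHomogeneous k P).diffOp hG)
  · intro j _ hj
    have hjP := homogeneousComponent_isHomogeneous j P
    rcases Nat.lt_or_ge d j with h | h
    · rw [hjP.diffOp_eq_zero hG h, map_zero]
    · rw [homogeneousComponent_of_mem (hjP.diffOp hG), if_neg (by omega)]
  · intro hkP
    rw [homogeneousComponent_eq_zero k P (by simpa using hkP)]
    simp

/-- Distinct components of P send F to distinct degrees, so they cannot cancel. -/
theorem homogeneousComponent_mem_diffAnn {F P : MvPolynomial σ K} {s : ℕ}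
    (hF : F.IsHomogeneous s) (hP : P ∈ diffAnn F) (k : ℕ) :
    homogeneousComponent k P ∈ diffAnn F := by
  rw [mem_diffAnn] at hP ⊢
  rcases Nat.lt_or_ge s k with h | h
  · exact (homogeneousComponent_isHomogeneous k P).diffOp_eq_zero hF h
  · rw [← homogeneousComponent_diffOp hF P h, hP, map_zero]

/-- A homogeneous polynomial of positive degree whose partial derivatives vanish is zero. -/
theorem eq_zero_of_pderiv_eq_zero [CharZero K] [Finite σ] {G : MvPolynomial σ K} {d : ℕ}
    (hG : G.IsHomogeneous (d + 1)) (h : ∀ i, pderiv i G = 0) : G = 0 := by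
  cases nonempty_fintype σ
  -- Euler's identity; characteristic zero then allows division by the degree.
  have := hG.sum_X_mul_pderiv
  simp only [h, mul_zero, Finset.sum_const_zero] at this
  rw [eq_comm, nsmul_eq_mul, mul_eq_zero] at this
  exact this.resolve_left (by exact_mod_cast Nat.succ_ne_zero d)

/-- The apolar pairing on polynomials of degree `d` is nondegenerate. -/
theorem eq_zero_of_forall_diffOp_eq_zero [CharZero K] [Finite σ] {d : ℕ} :
    ∀ {G : MvPolynomial σ K}, G.IsHomogeneous d →
      (∀ Q : MvPolynomial σ K, Q.IsHomogeneous d → diffOp σ K Q G = 0) → G = 0 := by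
  induction d with
  | zero =>
    intro G hG h
    simpa using h 1 (isHomogeneous_one σ K)
  | succ d ih =>
    intro G hG h
    refine eq_zero_of_pderiv_eq_zero hG fun i => ih (by simpa using hG.pderiv) fun Q hQ => ?_
    have := h (Q * X i) (hQ.mul (isHomogeneous_X K i))
    rw [diffOp_mul_apply, diffOp_X] at this
    exact this

/-- A polynomial all of whose partial derivatives vanish is constant. -/
theorem eq_C_of_pderiv_eq_zero [CharZero K] [Finite σ] {G : MvPolynomial σ K}
    (h : ∀ i, pderiv i G = 0) : G = C (constantCoeff G) := by
  classical
  ext b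
  rw [coeff_C]
  split_ifs with hb
  · rw [← hb]; rfl
  · obtain ⟨i, hi⟩ : ∃ i, b i ≠ 0 := by
      by_contra! h
      exact hb (Finsupp.ext h).symm
    -- The operator x_i ∂_i multiplies the coefficient at `b` by `b i`, which is nonzero.
    have hX := congrArg (coeff b) (show X i * pderiv i G = 0 by rw [h, mul_zero])
    have hle : Finsupp.single i 1 ≤ b := by
      rw [Finsupp.single_le_iff]; omega
    have hcoe : coeff b (X i * pderiv i G) = b i * coeff b G := by
      conv_lhs => rw [G.as_sum, map_sum, Finset.mul_sum]
      simp only [X_mul_pderiv_monomial, coeff_sum, coeff_smul, coeff_monomial]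
      rw [Finset.sum_eq_single b]
      · simp
      · intro c _ hc; simp [hc]
      · intro hb; simp [notMem_support_iff.1 hb]
    rw [hcoe, coeff_zero, mul_eq_zero] at hX
    exact hX.resolve_left (by exact_mod_cast hi)

end Apolarity

/-! ### The algebra K[x]/Ann(F) of a form: grading, Gorenstein property, duality. -/

section ApolarAlgebra

variable {σ K : Type*} [Field K]

/-- The `K`-linear map `P ↦ P(∂/∂x) F` from `K[x] / Ann(F)` to `K[x]`. -/
noncomputable def apolarMap (F : MvPolynomial σ K) :
    (MvPolynomial σ K ⧸ diffAnn F) →ₗ[K] MvPolynomial σ K :=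
  (((diffAnn F).restrictScalars K).liftQ
    ((LinearMap.applyₗ F).comp (diffOp σ K).toLinearMap) fun _ h => h).comp
    (Submodule.Quotient.restrictScalarsEquiv K (diffAnn F)).symm.toLinearMap

theorem apolarMap_injective (F : MvPolynomial σ K) : Function.Injective (apolarMap F) := by
  rw [injective_iff_map_eq_zero]
  intro a
  obtain ⟨P, rfl⟩ := Ideal.Quotient.mk_surjective a
  intro h
  exact Ideal.Quotient.eq_zero_iff_mem.2 h

theorem mk_mem_quotientGrading {I : Ideal (MvPolynomial σ K)} {P : MvPolynomial σ K} {k : ℕ}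
    (hP : P.IsHomogeneous k) : Ideal.Quotient.mk I P ∈ quotientGrading I k :=
  ⟨P, hP, rfl⟩

theorem mem_quotientGrading {I : Ideal (MvPolynomial σ K)} {a : MvPolynomial σ K ⧸ I} {k : ℕ} :
    a ∈ quotientGrading I k ↔ ∃ P, P.IsHomogeneous k ∧ Ideal.Quotient.mk I P = a := Iff.rfl

theorem quotientGrading_gradedMonoid (I : Ideal (MvPolynomial σ K)) :
    SetLike.GradedMonoid (quotientGrading I) where
  one_mem := ⟨1, isHomogeneous_one σ K, rfl⟩
  mul_mem := by
    rintro i j _ _ ⟨P, hP, rfl⟩ ⟨Q, hQ, rfl⟩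
    exact ⟨P * Q, hP.mul hQ, rfl⟩

instance quotientGrading_finite [Finite σ] (I : Ideal (MvPolynomial σ K)) (k : ℕ) :
    Module.Finite K (quotientGrading I k) :=
  Module.Finite.iff_fg.2 ((homogeneousSubmodule_fg σ K k).map _)

variable {F : MvPolynomial σ K} {s : ℕ}

theorem apolarMap_isHomogeneous (hF : F.IsHomogeneous s) {k : ℕ}
    {a : MvPolynomial σ K ⧸ diffAnn F} (ha : a ∈ quotientGrading (diffAnn F) k) :
    (apolarMap F a).IsHomogeneous (s - k) := by
  obtain ⟨P, hP, rfl⟩ := ha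
  exact hP.diffOp hF

theorem quotientGrading_eq_bot (hF : F.IsHomogeneous s) {k : ℕ} (hk : s < k) :
    quotientGrading (diffAnn F) k = ⊥ := by
  rw [eq_bot_iff]
  rintro _ ⟨P, hP, rfl⟩
  exact Ideal.Quotient.eq_zero_iff_mem.2 (hP.diffOp_eq_zero hF hk)

theorem eq_zero_of_mem_quotientGrading (hF : F.IsHomogeneous s) {k : ℕ} (hk : s < k)
    {a : MvPolynomial σ K ⧸ diffAnn F} (ha : a ∈ quotientGrading (diffAnn F) k) : a = 0 :=
  (Submodule.mem_bot K).1 (quotientGrading_eq_bot hF hk ▸ ha)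

/-- Independence is read off in K[x] through `apolarMap`: the component of degree s - k isolates
A_k. Degrees above s are treated apart, since there s - k truncates to 0. -/
theorem quotientGrading_isInternal (hF : F.IsHomogeneous s) :
    DirectSum.IsInternal (quotientGrading (diffAnn F)) := by
  classical
  rw [DirectSum.isInternal_submodule_iff_iSupIndep_and_iSup_eq_top]
  constructor
  · rw [iSupIndep_iff_forall_dfinsupp]
    intro k x v hv
    rcases Nat.lt_or_ge s k with hk | hk
    · exact Subtype.ext (eq_zero_of_mem_quotientGrading hF hk x.2)
    have h := congrArg (fun a => homogeneousComponent (s - k) (apolarMap F a)) hv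
    simp only [DFinsupp.lsum_apply_apply, DFinsupp.sumAddHom_apply, DFinsupp.sum, map_sum] at h
    rw [homogeneousComponent_eq_self (apolarMap_isHomogeneous hF x.2)] at h
    apply Subtype.ext
    apply apolarMap_injective F
    rw [ZeroMemClass.coe_zero, map_zero, ← h]
    refine Finset.sum_eq_zero fun j _ => ?_
    by_cases hj : j = k
    · subst hj; simp
    · set y := (DFinsupp.erase k v) j
      have hy := apolarMap_isHomogeneous hF y.2
      rcases Nat.lt_or_ge s j with hsj | hsj
      · change homogeneousComponent (s - k) (apolarMap F y) = 0
        rw [eq_zero_of_mem_quotientGrading hF hsj y.2, map_zero, map_zero]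
      · change homogeneousComponent (s - k) (apolarMap F y) = 0
        rw [homogeneousComponent_of_mem hy, if_neg (by omega)]
  · rw [eq_top_iff]
    rintro a -
    obtain ⟨P, rfl⟩ := Ideal.Quotient.mk_surjective a
    rw [← sum_homogeneousComponent P, map_sum]
    exact Submodule.sum_mem _ fun i _ => Submodule.mem_iSup_of_mem i
      (mk_mem_quotientGrading (homogeneousComponent_isHomogeneous i P))

theorem apolarAlgebra_finite [Finite σ] (hF : F.IsHomogeneous s) :
    Module.Finite K (MvPolynomial σ K ⧸ diffAnn F) := by
  have htop : (⨆ k : Fin (s + 1), quotientGrading (diffAnn F) k) = ⊤ := by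
    rw [eq_top_iff, ← (quotientGrading_isInternal hF).submodule_iSup_eq_top]
    refine iSup_le fun k => ?_
    rcases Nat.lt_or_ge s k with hk | hk
    · rw [quotientGrading_eq_bot hF hk]; exact bot_le
    · exact le_iSup (fun k : Fin (s + 1) => quotientGrading (diffAnn F) k) ⟨k, by omega⟩
  rw [Module.finite_def, ← htop]
  exact Submodule.fg_iSup _ fun k => Module.Finite.iff_fg.1 inferInstance

theorem constantCoeff_eq_zero_of_mem_diffAnn (hF : F.IsHomogeneous s) (h0 : F ≠ 0)
    {P : MvPolynomial σ K} (hP : P ∈ diffAnn F) : constantCoeff P = 0 := by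
  have h := homogeneousComponent_mem_diffAnn hF hP 0
  rw [homogeneousComponent_zero, mem_diffAnn, diffOp_C_apply, smul_eq_zero] at h
  exact h.resolve_right h0

/-- The augmentation `K[x] / Ann(F) → K`. -/
noncomputable def apolarAugmentation (hF : F.IsHomogeneous s) (h0 : F ≠ 0) :
    (MvPolynomial σ K ⧸ diffAnn F) →+* K :=
  Ideal.Quotient.lift (diffAnn F) constantCoeff
    fun _ hP => constantCoeff_eq_zero_of_mem_diffAnn hF h0 hP

/-- All components of P^(s+1) have degree above s, hence annihilate F. -/
theorem isNilpotent_of_constantCoeff_eq_zero (hF : F.IsHomogeneous s) {P : MvPolynomial σ K}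
    (hP : constantCoeff P = 0) : IsNilpotent (Ideal.Quotient.mk (diffAnn F) P) := by
  have hsub : ∀ k, ∀ i < k, homogeneousComponent i (P ^ k) = 0 := by
    intro k i hi
    ext b
    rw [coeff_homogeneousComponent]
    split_ifs with hb
    · rw [coeff_zero]
      by_contra hne
      have hmem : P ∈ idealOfVars σ K := by
        rw [← pow_one (idealOfVars σ K), mem_pow_idealOfVars_iff']
        intro b hb
        rwa [(Finsupp.degree_eq_zero_iff b).1 (Nat.lt_one_iff.1 hb)]
      exact hne ((mem_pow_idealOfVars_iff' k _).1 (Ideal.pow_mem_pow hmem k) b (by omega))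
    · rw [coeff_zero]
  refine ⟨s + 1, ?_⟩
  rw [← map_pow, Ideal.Quotient.eq_zero_iff_mem, mem_diffAnn, diffOp_eq_sum_homogeneousComponent]
  refine Finset.sum_eq_zero fun i _ => ?_
  rcases Nat.lt_or_ge s i with h | h
  · exact (homogeneousComponent_isHomogeneous i _).diffOp_eq_zero hF h
  · rw [hsub _ _ (by omega), map_zero, LinearMap.zero_apply]

/-- A nonzero constant plus a nilpotent is a unit. This makes A local, with the classes of zero
constant term as maximal ideal. -/
theorem isLocalHom_apolarAugmentation (hF : F.IsHomogeneous s) (h0 : F ≠ 0) :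
    IsLocalHom (apolarAugmentation hF h0) where
  map_nonunit a ha := by
    obtain ⟨P, rfl⟩ := Ideal.Quotient.mk_surjective a
    have hc : constantCoeff P ≠ 0 := ha.ne_zero
    have hn := isNilpotent_of_constantCoeff_eq_zero hF (P := P - C (constantCoeff P))
      (by simp)
    have hu : IsUnit (Ideal.Quotient.mk (diffAnn F) (C (constantCoeff P))) :=
      ((isUnit_iff_ne_zero.2 hc).map C).map _
    have := hn.isUnit_add_left_of_commute hu (Commute.all _ _)
    rwa [← map_add, add_sub_cancel] at this

variable [CharZero K] [Finite σ]

theorem quotientGrading_top_ne_bot (hF : F.IsHomogeneous s) (h0 : F ≠ 0) :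
    quotientGrading (diffAnn F) s ≠ ⊥ := by
  intro h
  refine h0 (eq_zero_of_forall_diffOp_eq_zero hF fun Q hQ => ?_)
  have := mk_mem_quotientGrading (I := diffAnn F) hQ
  rw [h, Submodule.mem_bot, Ideal.Quotient.eq_zero_iff_mem] at this
  exact this

theorem isGradedArtinian_apolarAlgebra (hF : F.IsHomogeneous s) (h0 : F ≠ 0) :
    IsGradedArtinian (quotientGrading (diffAnn F)) s where
  artinian :=
    have := apolarAlgebra_finite hF
    IsArtinianRing.of_finite K _
  graded := quotientGrading_gradedMonoid _
  internal := quotientGrading_isInternal hF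
  top_ne := quotientGrading_top_ne_bot hF h0
  eq_bot _ hk := quotientGrading_eq_bot hF hk

theorem isArtinianGorenstein_apolarAlgebra (hF : F.IsHomogeneous s) (h0 : F ≠ 0) :
    IsArtinianGorenstein (MvPolynomial σ K ⧸ diffAnn F) := by
  have hart := (isGradedArtinian_apolarAlgebra hF h0).artinian
  have hlh := isLocalHom_apolarAugmentation hF h0
  have hloc : IsLocalRing (MvPolynomial σ K ⧸ diffAnn F) :=
    (apolarAugmentation hF h0).domain_isLocalRing
  have hmem : ∀ P, Ideal.Quotient.mk (diffAnn F) P ∈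
      IsLocalRing.maximalIdeal (MvPolynomial σ K ⧸ diffAnn F) ↔ constantCoeff P = 0 := by
    intro P
    rw [IsLocalRing.mem_maximalIdeal, mem_nonunits_iff,
      ← isUnit_map_iff (apolarAugmentation hF h0), isUnit_iff_ne_zero, not_not]
    rfl
  have hconst : ∀ a ∈ (IsLocalRing.maximalIdeal (MvPolynomial σ K ⧸ diffAnn F)).annihilator,
      ∃ c, apolarMap F a = C c := by
    intro a ha
    obtain ⟨P, rfl⟩ := Ideal.Quotient.mk_surjective a
    refine ⟨_, eq_C_of_pderiv_eq_zero fun i => ?_⟩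
    rw [Submodule.mem_annihilator] at ha
    have := ha (Ideal.Quotient.mk _ (X i)) ((hmem _).2 (by simp))
    rw [smul_eq_mul, ← map_mul, Ideal.Quotient.eq_zero_iff_mem, mul_comm, mem_diffAnn,
      diffOp_X_mul_apply] at this
    exact this
  refine { hart, hloc with isSimple_socle := ?_ }
  rw [isSimpleModule_iff_toSpanSingleton_surjective]
  constructor
  -- A nonzero element of A_s lies in the socle: it sends F to a constant, which every operator
  -- without constant term kills.
  · obtain ⟨a, ha, ha0⟩ := Submodule.exists_mem_ne_zero_of_ne_bot
      (quotientGrading_top_ne_bot hF h0)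
    refine ⟨⟨⟨a, ?_⟩, 0, fun h => ha0 (congrArg Subtype.val h)⟩⟩
    rw [Submodule.mem_annihilator]
    intro b hb
    obtain ⟨P, hP, rfl⟩ := mem_quotientGrading.1 ha
    obtain ⟨Q, rfl⟩ := Ideal.Quotient.mk_surjective b
    rw [hmem] at hb
    rw [smul_eq_mul, ← map_mul, Ideal.Quotient.eq_zero_iff_mem, mul_comm, mem_diffAnn,
      diffOp_mul_apply]
    have h1 := hP.diffOp hF
    rw [Nat.sub_self, ← totalDegree_zero_iff_isHomogeneous, totalDegree_eq_zero_iff_eq_C] at h1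
    rw [h1, diffOp_eq_sum_homogeneousComponent]
    refine Finset.sum_eq_zero fun i _ => ?_
    rcases Nat.eq_zero_or_pos i with rfl | hi
    · rw [homogeneousComponent_zero]
      rw [show coeff 0 Q = 0 from hb, map_zero, map_zero, LinearMap.zero_apply]
    · exact (homogeneousComponent_isHomogeneous i Q).diffOp_eq_zero (isHomogeneous_C _ _) hi
  -- Socle elements embed into the constants, so any two are proportional.
  · rintro ⟨x, hx⟩ hx0 ⟨y, hy⟩
    obtain ⟨a, ha⟩ := hconst x hx
    obtain ⟨b, hb⟩ := hconst y hy
    have ha0 : a ≠ 0 := by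
      rintro rfl
      rw [map_zero] at ha
      exact hx0 (Subtype.ext (apolarMap_injective F (by rw [ha]; simp)))
    refine ⟨algebraMap K _ (b / a), Subtype.ext (apolarMap_injective F ?_)⟩
    rw [LinearMap.toSpanSingleton_apply, SetLike.val_smul, smul_eq_mul, ← Algebra.smul_def,
      map_smul, ha, hb, smul_eq_C_mul, ← C_mul, div_mul_cancel₀ _ ha0]

/-- The bilinear pairing `(a, b) ↦ (ab)(∂/∂x) F` between complementary degrees. -/
noncomputable def apolarPairing (F : MvPolynomial σ K) (k m : ℕ) :
    quotientGrading (diffAnn F) k →ₗ[K] Module.Dual K (quotientGrading (diffAnn F) m) :=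
  ((LinearMap.mul K (MvPolynomial σ K ⧸ diffAnn F)).compr₂
    ((lcoeff K 0).comp (apolarMap F))).domRestrict₁₂ _ _

/-- If P pairs to zero with all of A_m, then P(∂)F is a form of degree m killed by every operator of
order m, hence zero. -/
theorem apolarPairing_injective (hF : F.IsHomogeneous s) {k m : ℕ} (h : k + m = s) :
    Function.Injective (apolarPairing F k m) := by
  rw [injective_iff_map_eq_zero]
  rintro ⟨_, P, hP, rfl⟩ h0
  apply Subtype.ext
  refine Ideal.Quotient.eq_zero_iff_mem.2 ?_
  have hPF : (diffOp σ K P F).IsHomogeneous m := by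
    simpa [← h] using hP.diffOp hF
  refine eq_zero_of_forall_diffOp_eq_zero hPF fun Q hQ => ?_
  have hQP := hQ.diffOp hPF
  rw [Nat.sub_self, ← totalDegree_zero_iff_isHomogeneous, totalDegree_eq_zero_iff_eq_C] at hQP
  have := LinearMap.congr_fun h0 ⟨_, mk_mem_quotientGrading hQ⟩
  change coeff 0 (diffOp σ K (P * Q) F) = 0 at this
  rw [mul_comm, diffOp_mul_apply] at this
  rw [hQP, this, map_zero]

theorem finrank_quotientGrading_le (hF : F.IsHomogeneous s) {k m : ℕ} (h : k + m = s) :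
    Module.finrank K (quotientGrading (diffAnn F) k) ≤
      Module.finrank K (quotientGrading (diffAnn F) m) := by
  rw [← Subspace.dual_finrank_eq (V := quotientGrading (diffAnn F) m)]
  exact LinearMap.finrank_le_finrank_of_injective (apolarPairing_injective hF h)

/-- By duality, injectivity of multiplication between complementary degrees is enough. -/
theorem bijOn_mul_of_injective (hF : F.IsHomogeneous s) {k m d : ℕ} (h : k + m = s)
    {a : MvPolynomial σ K ⧸ diffAnn F} (ha : a ∈ quotientGrading (diffAnn F) d) (hd : d + k = m)
    (hinj : ∀ b ∈ quotientGrading (diffAnn F) k, a * b = 0 → b = 0) :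
    Set.BijOn (fun b => a * b) (quotientGrading (diffAnn F) k : Set _)
      (quotientGrading (diffAnn F) m : Set _) := by
  have hmaps : ∀ b ∈ quotientGrading (diffAnn F) k,
      LinearMap.mulLeft K a b ∈ quotientGrading (diffAnn F) m := fun b hb =>
    hd ▸ (quotientGrading_gradedMonoid (diffAnn F)).mul_mem ha hb
  have hi : Function.Injective ((LinearMap.mulLeft K a).restrict hmaps) := by
    rw [injective_iff_map_eq_zero]
    rintro ⟨b, hb⟩ h0
    exact Subtype.ext (hinj b hb (congrArg Subtype.val h0))
  have hs := (LinearMap.injective_iff_surjective_of_finrank_eq_finrank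
    (le_antisymm (finrank_quotientGrading_le hF h)
      (finrank_quotientGrading_le hF (by omega)))).1 hi
  refine ⟨hmaps, ?_, ?_⟩
  · intro b hb c hc hbc
    exact congrArg Subtype.val (@hi ⟨b, hb⟩ ⟨c, hc⟩ (Subtype.ext hbc))
  · intro c hc
    obtain ⟨⟨b, hb⟩, hbc⟩ := hs ⟨c, hc⟩
    exact ⟨b, hb, congrArg Subtype.val hbc⟩

end ApolarAlgebra

/-! ### The Hessian criterion at (1, …, 1). -/

section LefschetzCriterion

variable {σ K : Type*} [Field K]

theorem diffOp_sum_X_apply [Fintype σ] (G : MvPolynomial σ K) :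
    diffOp σ K (∑ i, X i) G = ∑ i, pderiv i G := by
  simp [map_sum, LinearMap.sum_apply, diffOp_X]

/-- Applying `(∑ ∂ᵢ)^d` to a form of degree `d` evaluates it at `(1, …, 1)`, up to `d!`. -/
theorem eval_one_diffOp_sum_X_pow [Fintype σ] {d : ℕ} :
    ∀ {G : MvPolynomial σ K}, G.IsHomogeneous d →
      eval (fun _ => 1) (diffOp σ K ((∑ i, X i) ^ d) G) =
        d.factorial * eval (fun _ => (1 : K)) G := by
  induction d with
  | zero => intro G _; simp
  | succ d ih =>
    intro G hG
    have hsum : (∑ i, pderiv i G).IsHomogeneous d :=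
      IsHomogeneous.sum _ _ _ fun i _ => by simpa using hG.pderiv
    rw [pow_succ, diffOp_mul_apply, diffOp_sum_X_apply, ih hsum]
    have he := congrArg (eval fun _ => (1 : K)) hG.sum_X_mul_pderiv
    simp only [map_sum, map_mul, eval_X, one_mul, map_nsmul] at he ⊢
    rw [he, Nat.factorial_succ, nsmul_eq_mul]
    push_cast
    ring

theorem pderiv_prod_X [DecidableEq σ] (i : σ) (T : Finset σ) :
    pderiv i (∏ e ∈ T, (X e : MvPolynomial σ K)) =
      if i ∈ T then ∏ e ∈ T.erase i, X e else 0 := by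
  have hzero : ∀ S : Finset σ, i ∉ S → pderiv i (∏ e ∈ S, (X e : MvPolynomial σ K)) = 0 := by
    intro S
    induction S using Finset.induction_on with
    | empty => simp
    | insert e S he ih =>
      intro hi
      rw [Finset.mem_insert, not_or] at hi
      rw [Finset.prod_insert he, pderiv_mul, ih hi.2, pderiv_X_of_ne (Ne.symm hi.1)]
      simp
  split_ifs with h
  · rw [← Finset.mul_prod_erase _ _ h, pderiv_mul, hzero _ (Finset.notMem_erase i T),
      pderiv_X_self]
    simp
  · exact hzero T h

theorem eval_one_pderiv_pderiv_prod_X [DecidableEq σ] (i j : σ) (T : Finset σ) :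
    eval (fun _ => (1 : K)) (pderiv j (pderiv i (∏ e ∈ T, (X e : MvPolynomial σ K)))) =
      if i ≠ j ∧ i ∈ T ∧ j ∈ T then 1 else 0 := by
  rw [pderiv_prod_X]
  split_ifs with h1 h2 h2
  · rw [pderiv_prod_X, if_pos (by grind)]; simp [map_prod]
  · rw [pderiv_prod_X, if_neg (by grind)]; simp
  · grind
  · simp

variable [CharZero K] [Fintype σ] {F : MvPolynomial σ K} {s : ℕ}

/-- For socle degree at most four, the sum of the variables is a strong Lefschetz element as soon
as `F` and its Hessian do not vanish at `(1, …, 1)`. -/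
theorem isStrongLefschetzElement_sum_X (hF : F.IsHomogeneous s) (hs : s ≤ 4)
    (h1 : eval (fun _ => (1 : K)) F ≠ 0)
    (h2 : 3 ≤ s → ∀ p : σ → K,
      (∀ j, ∑ i, p i * eval (fun _ => (1 : K)) (pderiv j (pderiv i F)) = 0) → p = 0) :
    IsStrongLefschetzElement (quotientGrading (diffAnn F)) s
      (Ideal.Quotient.mk (diffAnn F) (∑ i, X i)) where
  mem := mk_mem_quotientGrading (IsHomogeneous.sum _ _ _ fun i _ => isHomogeneous_X K i)
  bij k hk := by
    have hL : (Ideal.Quotient.mk (diffAnn F) (∑ i, X i)) ^ (s - 2 * k) ∈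
        quotientGrading (diffAnn F) (s - 2 * k) := by
      rw [← map_pow]
      refine mk_mem_quotientGrading ?_
      simpa using (IsHomogeneous.sum Finset.univ (fun i : σ => (X i : MvPolynomial σ K)) 1
        fun i _ => isHomogeneous_X K i).pow (s - 2 * k)
    refine bijOn_mul_of_injective hF (by omega) hL (by omega) ?_
    intro b hb hLb
    rcases Nat.eq_or_lt_of_le hk with hks | hks
    · simpa [hks] using hLb
    obtain ⟨P, hP, rfl⟩ := mem_quotientGrading.1 hb
    rw [← map_pow, ← map_mul, Ideal.Quotient.eq_zero_iff_mem, mem_diffAnn,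
      diffOp_mul_apply] at hLb
    obtain rfl | rfl : k = 0 ∨ k = 1 := by omega
    · rw [← totalDegree_zero_iff_isHomogeneous, totalDegree_eq_zero_iff_eq_C] at hP
      rw [hP, diffOp_C_apply, map_smul, mul_zero, Nat.sub_zero] at hLb
      have := congrArg (eval fun _ => (1 : K)) hLb
      rw [smul_eval, eval_one_diffOp_sum_X_pow hF, map_zero, mul_eq_zero, mul_eq_zero] at this
      have hc : coeff 0 P = 0 := by
        refine this.resolve_right (not_or.2 ⟨?_, h1⟩)
        exact_mod_cast s.factorial_ne_zero
      rw [hP, hc, map_zero, map_zero]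
    · have hspan : P ∈ homogeneousSubmodule σ K 1 := hP
      rw [homogeneousSubmodule_one_eq_span_X, Submodule.mem_span_range_iff_exists_fun] at hspan
      obtain ⟨p, rfl⟩ := hspan
      have hp : p = 0 := by
        refine h2 (by omega) p fun j => ?_
        -- One extra ∂_j lowers the degree to s - 2, so L^{s-2} acts as evaluation at (1, …, 1) up
        -- to (s-2)!, giving row j of the Hessian.
        have hQ : (pderiv j (diffOp σ K (∑ i, p i • X i) F)).IsHomogeneous (s - 2 * 1) :=
          (hP.diffOp hF).pderiv
        have := congrArg (fun G => eval (fun _ => (1 : K)) (pderiv j G)) hLb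
        rw [← diffOp_X_mul_apply, mul_comm, diffOp_mul_apply, diffOp_X] at this
        rw [Derivation.coeFn_coe,
          eval_one_diffOp_sum_X_pow hQ, map_zero, map_zero, mul_eq_zero] at this
        have := this.resolve_left (by exact_mod_cast Nat.factorial_ne_zero _)
        simpa [map_sum, LinearMap.sum_apply, diffOp_X] using this
      simp [hp]

end LefschetzCriterion

/-! ### Spanning trees through cuts, and counts invariant under automorphisms. -/

section SpanningTrees

variable {V : Type*} {G : SimpleGraph V}

theorem edgeSet_fromEdgeSet_image_val (T : Finset G.edgeSet) :
    (SimpleGraph.fromEdgeSet (Subtype.val '' (T : Set G.edgeSet))).edgeSet =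
      Subtype.val '' (T : Set G.edgeSet) := by
  rw [SimpleGraph.edgeSet_fromEdgeSet, sdiff_eq_left, Set.disjoint_left]
  rintro _ ⟨e, -, rfl⟩
  exact G.not_isDiag_of_mem_edgeSet e.2

theorem nat_card_edgeSet_fromEdgeSet (T : Finset G.edgeSet) :
    Nat.card (SimpleGraph.fromEdgeSet (Subtype.val '' (T : Set G.edgeSet))).edgeSet = T.card := by
  rw [edgeSet_fromEdgeSet_image_val, Nat.card_image_of_injective Subtype.val_injective,
    Nat.card_coe_set_eq, Set.ncard_coe_finset]

theorem IsSpanningTree.card_add_one [Fintype V] {T : Finset G.edgeSet} (h : IsSpanningTree G T) :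
    T.card + 1 = Fintype.card V := by
  rw [← nat_card_edgeSet_fromEdgeSet, ← Nat.card_eq_fintype_card]
  exact (SimpleGraph.isTree_iff_connected_and_card.1 h).2

theorem exists_isSpanningTree [Finite V] (h : G.Connected) : ∃ T, IsSpanningTree G T := by
  classical
  cases nonempty_fintype V
  obtain ⟨H, hle, hH⟩ := h.exists_isTree_le
  refine ⟨Finset.univ.filter fun e => e.1 ∈ H.edgeSet, ?_⟩
  have : Subtype.val '' ((Finset.univ.filter fun e : G.edgeSet => e.1 ∈ H.edgeSet : Finset _) :
      Set G.edgeSet) = H.edgeSet := by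
    ext e
    simpa using fun he => SimpleGraph.edgeSet_mono hle he
  rwa [IsSpanningTree, this, SimpleGraph.fromEdgeSet_edgeSet]

/-- The edge `e` joins a vertex of `S` to a vertex outside `S`. -/
def CrossesCut (S : Finset V) (e : Sym2 V) : Prop :=
  (∃ i ∈ e, i ∈ S) ∧ ∃ j ∈ e, j ∉ S

instance [Fintype V] [DecidableEq V] (S : Finset V) (e : Sym2 V) : Decidable (CrossesCut S e) :=
  inferInstanceAs (Decidable (_ ∧ _))

/-- Every cut of the vertex set is crossed by an edge in `T`. -/
def CrossesAllCuts [Fintype V] (T : Finset G.edgeSet) : Prop :=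
  ∀ S : Finset V, S.Nonempty → S ≠ Finset.univ → ∃ e ∈ T, CrossesCut S e.1

instance [Fintype V] [DecidableEq V] : DecidablePred (CrossesAllCuts (G := G)) := fun T =>
  inferInstanceAs (Decidable (∀ S : Finset V, S.Nonempty → S ≠ Finset.univ →
    ∃ e ∈ T, CrossesCut S e.1))

theorem crossesCut_mk_iff {S : Finset V} {i j : V} (hi : i ∈ S) :
    CrossesCut S s(i, j) ↔ j ∉ S := by
  simp [CrossesCut, hi]

/-- Cuts turn connectedness into a finite condition that the kernel can evaluate. -/
theorem preconnected_iff_crossesAllCuts [Fintype V] (T : Finset G.edgeSet) :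
    (SimpleGraph.fromEdgeSet (Subtype.val '' (T : Set G.edgeSet))).Preconnected ↔
      CrossesAllCuts T := by
  classical
  set H := SimpleGraph.fromEdgeSet (Subtype.val '' (T : Set G.edgeSet)) with hH
  have hE : H.edgeSet = Subtype.val '' (T : Set G.edgeSet) := edgeSet_fromEdgeSet_image_val T
  constructor
  · rintro h S ⟨u, hu⟩ hS
    obtain ⟨v, hv⟩ : ∃ v, v ∉ S := by
      by_contra! hall
      exact hS (Finset.eq_univ_iff_forall.2 hall)
    obtain ⟨p⟩ := h u v
    obtain ⟨d, -, h1, h2⟩ := p.exists_boundary_dart (S : Set V) hu hv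
    have hd := d.edge_mem
    rw [hE] at hd
    obtain ⟨e, he, hed⟩ := hd
    refine ⟨e, he, ?_⟩
    rw [hed]
    exact (crossesCut_mk_iff h1).2 h2
  · intro h u v
    by_contra huv
    -- No edge of `T` can leave the connected component of `u`.
    obtain ⟨⟨e, heG⟩, he, hcross⟩ := h (Finset.univ.filter fun w => H.Reachable u w)
      ⟨u, by simp⟩ (fun hall => huv (by simpa using Finset.eq_univ_iff_forall.1 hall v))
    obtain ⟨⟨i, hie, hi⟩, j, hje, hj⟩ := hcross
    rw [Finset.mem_filter_univ] at hi hj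
    refine hj (hi.trans (SimpleGraph.Adj.reachable ?_))
    have hij : i ≠ j := by rintro rfl; exact hj hi
    rw [← SimpleGraph.mem_edgeSet, hE]
    exact ⟨⟨e, heG⟩, he, (Sym2.mem_and_mem_iff hij).1 ⟨hie, hje⟩⟩

theorem isSpanningTree_iff [Fintype V] [Nonempty V] (T : Finset G.edgeSet) :
    IsSpanningTree G T ↔ T.card + 1 = Fintype.card V ∧ CrossesAllCuts T := by
  rw [IsSpanningTree, SimpleGraph.isTree_iff_connected_and_card, nat_card_edgeSet_fromEdgeSet,
    Nat.card_eq_fintype_card, SimpleGraph.connected_iff, preconnected_iff_crossesAllCuts,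
    and_iff_left ‹Nonempty V›, and_comm]

theorem IsSpanningTree.map {W : Type*} {G' : SimpleGraph W} (f : G ≃g G') {T : Finset G.edgeSet}
    (h : IsSpanningTree G T) : IsSpanningTree G' (T.map f.mapEdgeSet.toEmbedding) := by
  refine (SimpleGraph.Iso.isTree_iff ⟨f.toEquiv, ?_⟩).1 h
  intro a b
  simp only [SimpleGraph.fromEdgeSet_adj]
  refine and_congr ?_ (by simp)
  have hval : ∀ e : G.edgeSet, (f.mapEdgeSet e).1 = Sym2.map f e.1 := fun _ => rfl
  have hmap : s(f.toEquiv a, f.toEquiv b) = Sym2.map f s(a, b) := rfl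
  rw [hmap]
  constructor
  · rintro ⟨_, he', h⟩
    rw [Finset.mem_coe, Finset.mem_map] at he'
    obtain ⟨e, he, rfl⟩ := he'
    exact ⟨e, he, Sym2.map.injective f.injective h⟩
  · rintro ⟨e, he, h⟩
    exact ⟨f.mapEdgeSet e, Finset.mem_coe.2 (Finset.mem_map_of_mem _ he), by rw [hval, h]⟩

/-- The number of spanning trees through two given edges. -/
noncomputable def spanningTreeCount (G : SimpleGraph V) (e f : G.edgeSet) : ℕ :=
  {T : Finset G.edgeSet | IsSpanningTree G T ∧ e ∈ T ∧ f ∈ T}.ncard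

theorem spanningTreeCount_le_map [Finite V] (π : G ≃g G) (e f : G.edgeSet) :
    spanningTreeCount G e f ≤ spanningTreeCount G (π.mapEdgeSet e) (π.mapEdgeSet f) := by
  classical
  cases nonempty_fintype V
  refine Set.ncard_le_ncard_of_injOn (fun T => T.map π.mapEdgeSet.toEmbedding) ?_
    ((Finset.map_injective _).injOn) (Set.toFinite _)
  rintro T ⟨h, he, hf⟩
  exact ⟨h.map π, Finset.mem_map_of_mem _ he, Finset.mem_map_of_mem _ hf⟩

theorem spanningTreeCount_map [Finite V] (π : G ≃g G) (e f : G.edgeSet) :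
    spanningTreeCount G (π.mapEdgeSet e) (π.mapEdgeSet f) = spanningTreeCount G e f := by
  refine le_antisymm ?_ (spanningTreeCount_le_map π e f)
  have := spanningTreeCount_le_map π.symm (π.mapEdgeSet e) (π.mapEdgeSet f)
  rwa [show π.symm.mapEdgeSet (π.mapEdgeSet e) = e from π.mapEdgeSet.symm_apply_apply e,
    show π.symm.mapEdgeSet (π.mapEdgeSet f) = f from π.mapEdgeSet.symm_apply_apply f] at this

theorem spanningTreeCount_eq_card [Fintype V] [DecidableEq V] [Nonempty V]
    [DecidableRel G.Adj] (e f : G.edgeSet) :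
    spanningTreeCount G e f =
      (((Finset.univ.powersetCard (Fintype.card V - 1)).filter fun T => e ∈ T ∧ f ∈ T).filter
        fun T => CrossesAllCuts T).card := by
  rw [spanningTreeCount, ← Set.ncard_coe_finset]
  congr 1
  ext T
  have : 0 < Fintype.card V := Fintype.card_pos
  have : T.card + 1 = Fintype.card V ↔ T.card = Fintype.card V - 1 := by omega
  simp only [isSpanningTree_iff, Set.mem_ofPred_eq, Finset.coe_filter, Finset.mem_filter,
    Finset.mem_powersetCard, Finset.subset_univ, true_and, this]
  tauto

end SpanningTrees

/-! ### The Kirchhoff polynomial and its Hessian at (1, …, 1). -/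

section Kirchhoff

variable {V : Type*} [Fintype V] {K : Type*} [Field K] {G : SimpleGraph V}

theorem kirchhoffPolynomial_isHomogeneous :
    (kirchhoffPolynomial K G).IsHomogeneous (Fintype.card V - 1) := by
  classical
  unfold kirchhoffPolynomial
  refine IsHomogeneous.sum _ _ _ fun T hT => ?_
  replace hT : IsSpanningTree G T := (Finset.mem_filter.1 hT).2
  have := IsHomogeneous.prod T (fun e : G.edgeSet => (X e : MvPolynomial _ K)) (fun _ => 1)
    fun e _ => isHomogeneous_X K e
  rwa [Finset.sum_const, smul_eq_mul, mul_one,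
    show T.card = Fintype.card V - 1 by have := hT.card_add_one; omega] at this

theorem eval_one_kirchhoffPolynomial_ne_zero [CharZero K] (h : G.Connected) :
    eval (fun _ => (1 : K)) (kirchhoffPolynomial K G) ≠ 0 := by
  classical
  obtain ⟨T, hT⟩ := exists_isSpanningTree h
  simp only [kirchhoffPolynomial, map_sum, map_prod, eval_X, Finset.prod_const_one,
    Finset.sum_const, nsmul_eq_mul, mul_one]
  exact_mod_cast Finset.card_ne_zero_of_mem (Finset.mem_filter.2 ⟨Finset.mem_univ _, hT⟩)

/-- The monomials are squarefree, so the diagonal vanishes and each tree through both edges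
contributes 1 off it. -/
theorem eval_one_pderiv_pderiv_kirchhoffPolynomial [DecidableEq G.edgeSet] (e f : G.edgeSet) :
    eval (fun _ => (1 : K)) (pderiv f (pderiv e (kirchhoffPolynomial K G))) =
      (if e = f then 0 else spanningTreeCount G e f : ℕ) := by
  classical
  simp only [kirchhoffPolynomial, map_sum, eval_one_pderiv_pderiv_prod_X, Finset.sum_boole,
    Finset.filter_filter]
  congr 1
  split_ifs with h
  · simp [h]
  · rw [spanningTreeCount, ← Set.ncard_coe_finset]
    congr 1
    ext T
    simp [h]

end Kirchhoff

open MvPolynomial SimpleGraph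

/-! ### Symmetry of the complete graph: orbits of pairs of edges. -/

section CompleteGraph

variable {V : Type*}

theorem exists_perm_apply_eq {k : ℕ} (x y : Fin k ↪ V) :
    ∃ π : Equiv.Perm V, ∀ i, π (x i) = y i := by
  obtain ⟨π, hπ⟩ := (Equiv.Perm.isMultiplyPretransitive V k).exists_smul_eq x y
  exact ⟨π, fun i => DFunLike.congr_fun hπ i⟩

variable [Finite V]

theorem spanningTreeCount_completeGraph_congr {e f e' f' : (completeGraph V).edgeSet}
    (π : Equiv.Perm V) (he : Sym2.map π e.1 = e'.1) (hf : Sym2.map π f.1 = f'.1) :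
    spanningTreeCount (completeGraph V) e f = spanningTreeCount (completeGraph V) e' f' := by
  rw [← spanningTreeCount_map (SimpleGraph.Iso.completeGraph π) e f]
  congr 1 <;> exact Subtype.ext ‹_›

/-- The number of spanning trees through two adjacent edges does not depend on the edges. -/
theorem spanningTreeCount_adjacent {e f e' f' : (completeGraph V).edgeSet}
    {v v' : V} (he : v ∈ e.1) (hf : v ∈ f.1) (hef : e ≠ f) (he' : v' ∈ e'.1) (hf' : v' ∈ f'.1)
    (hef' : e' ≠ f') :
    spanningTreeCount (completeGraph V) e f = spanningTreeCount (completeGraph V) e' f' := by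
  obtain ⟨e, hE⟩ := e
  obtain ⟨f, hF⟩ := f
  obtain ⟨e', hE'⟩ := e'
  obtain ⟨f', hF'⟩ := f'
  obtain ⟨a, rfl⟩ := he
  obtain ⟨b, rfl⟩ := hf
  obtain ⟨a', rfl⟩ := he'
  obtain ⟨b', rfl⟩ := hf'
  have hva : v ≠ a := hE
  have hvb : v ≠ b := hF
  have hva' : v' ≠ a' := hE'
  have hvb' : v' ≠ b' := hF'
  simp only [ne_eq, Subtype.mk.injEq, Sym2.congr_right] at hef hef'
  obtain ⟨π, hπ⟩ := exists_perm_apply_eq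
    (⟨![v, a, b], by
      simp [Function.Injective, Fin.forall_fin_succ, *, Ne.symm, eq_comm]⟩ : Fin 3 ↪ V)
    ⟨![v', a', b'], by simp [Function.Injective, Fin.forall_fin_succ, *, Ne.symm, eq_comm]⟩
  have h0 : π v = v' := hπ 0
  have h1 : π a = a' := hπ 1
  have h2 : π b = b' := hπ 2
  exact spanningTreeCount_completeGraph_congr π (by simp [h0, h1]) (by simp [h0, h2])

/-- The number of spanning trees through two disjoint edges does not depend on the edges. -/
theorem spanningTreeCount_disjoint {e f e' f' : (completeGraph V).edgeSet}
    (hef : ∀ v ∈ e.1, v ∉ f.1) (hef' : ∀ v ∈ e'.1, v ∉ f'.1) :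
    spanningTreeCount (completeGraph V) e f = spanningTreeCount (completeGraph V) e' f' := by
  obtain ⟨⟨a, b⟩, hE⟩ := e
  obtain ⟨⟨c, d⟩, hF⟩ := f
  obtain ⟨⟨a', b'⟩, hE'⟩ := e'
  obtain ⟨⟨c', d'⟩, hF'⟩ := f'
  have hab : a ≠ b := hE
  have hcd : c ≠ d := hF
  have hab' : a' ≠ b' := hE'
  have hcd' : c' ≠ d' := hF'
  have hc := fun h => hef c h (Sym2.mem_mk_left c d)
  have hd := fun h => hef d h (Sym2.mem_mk_right c d)
  have hc' := fun h => hef' c' h (Sym2.mem_mk_left c' d')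
  have hd' := fun h => hef' d' h (Sym2.mem_mk_right c' d')
  simp only [Sym2.mem_iff, imp_false, not_or] at hc hd hc' hd'
  obtain ⟨π, hπ⟩ := exists_perm_apply_eq
    (⟨![a, b, c, d], by simp [Function.Injective, Fin.forall_fin_succ]; grind⟩ : Fin 4 ↪ V)
    ⟨![a', b', c', d'], by simp [Function.Injective, Fin.forall_fin_succ]; grind⟩
  have h0 : π a = a' := hπ 0
  have h1 : π b = b' := hπ 1
  have h2 : π c = c' := hπ 2
  have h3 : π d = d' := hπ 3
  refine spanningTreeCount_completeGraph_congr π ?_ ?_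
  · change s(π a, π b) = _; rw [h0, h1]
  · change s(π c, π d) = _; rw [h2, h3]

end CompleteGraph

/-! ### Explicit Hessians for K_4 and K_5, and the conclusion. -/

/-- The function on pairs of edges with value `x` on equal, `y` on adjacent and `z` on disjoint
edges. -/
def edgePairWeight {V R : Type*} [Fintype V] [DecidableEq V] (x y z : R)
    (e f : (completeGraph V).edgeSet) : R :=
  if e = f then x else if ∃ v ∈ e.1, v ∈ f.1 then y else z

/-- Matrices constant on equal, adjacent and disjoint pairs are closed under products, so the
inverse of the Hessian has the same shape; it is scaled to integers. -/
theorem sum_edgePairWeight_mul_four : ∀ e g : (completeGraph (Fin 4)).edgeSet,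
    ∑ f, edgePairWeight 0 3 4 e f * edgePairWeight (-9) 3 (-1) f g =
      if e = g then (32 : ℤ) else 0 := by
  decide +kernel

theorem sum_edgePairWeight_mul_five : ∀ e g : (completeGraph (Fin 5)).edgeSet,
    ∑ f, edgePairWeight 0 15 20 e f * edgePairWeight (-49) 11 (-4) f g =
      if e = g then (750 : ℤ) else 0 := by
  decide +kernel

/-- One representative per orbit is counted. The values for n = 4, 5 agree with 3n^{n-4} for
adjacent and 4n^{n-4} for disjoint edges. -/
theorem spanningTreeCount_four (e f : (completeGraph (Fin 4)).edgeSet) :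
    (if e = f then 0 else spanningTreeCount _ e f : ℕ) = edgePairWeight 0 3 4 e f := by
  have hadj : spanningTreeCount (completeGraph (Fin 4)) ⟨s(0, 1), by simp⟩ ⟨s(0, 2), by simp⟩ =
      3 := by
    rw [spanningTreeCount_eq_card]
    decide +kernel
  have hdisj : spanningTreeCount (completeGraph (Fin 4)) ⟨s(0, 1), by simp⟩ ⟨s(2, 3), by simp⟩ =
      4 := by
    rw [spanningTreeCount_eq_card]
    decide +kernel
  unfold edgePairWeight
  split_ifs with h1 h2
  · rfl
  · obtain ⟨v, he, hf⟩ := h2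
    exact (spanningTreeCount_adjacent he hf h1 (v' := 0) (by simp) (by simp) (by simp)).trans hadj
  · push Not at h2
    exact (spanningTreeCount_disjoint h2 (by simp)).trans hdisj

theorem spanningTreeCount_five (e f : (completeGraph (Fin 5)).edgeSet) :
    (if e = f then 0 else spanningTreeCount _ e f : ℕ) = edgePairWeight 0 15 20 e f := by
  have hadj : spanningTreeCount (completeGraph (Fin 5)) ⟨s(0, 1), by simp⟩ ⟨s(0, 2), by simp⟩ =
      15 := by
    rw [spanningTreeCount_eq_card]
    decide +kernel
  have hdisj : spanningTreeCount (completeGraph (Fin 5)) ⟨s(0, 1), by simp⟩ ⟨s(2, 3), by simp⟩ =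
      20 := by
    rw [spanningTreeCount_eq_card]
    decide +kernel
  unfold edgePairWeight
  split_ifs with h1 h2
  · rfl
  · obtain ⟨v, he, hf⟩ := h2
    exact (spanningTreeCount_adjacent he hf h1 (v' := 0) (by simp) (by simp) (by simp)).trans hadj
  · push Not at h2
    exact (spanningTreeCount_disjoint h2 (by simp)).trans hdisj

/-- A matrix with a scalar inverse up to a nonzero integer has trivial kernel. -/
theorem eq_zero_of_sum_mul_eq_zero {ι K : Type*} [Fintype ι] [DecidableEq ι] [Field K]
    [CharZero K] {M : ι → ι → ℕ} {N : ι → ι → ℤ} {c : ℤ} (hc : c ≠ 0)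
    (hMN : ∀ i k, ∑ j, (M i j : ℤ) * N j k = if i = k then c else 0) {p : ι → K}
    (hp : ∀ j, ∑ i, p i * (M i j : K) = 0) : p = 0 := by
  funext k
  have h : ∑ j, (∑ i, p i * (M i j : K)) * (N j k : K) = 0 := by simp [hp]
  simp only [Finset.sum_mul, mul_assoc] at h
  rw [Finset.sum_comm] at h
  simp only [← Finset.mul_sum] at h
  have hcast : ∀ i, ∑ j, (M i j : K) * (N j k : K) = if i = k then (c : K) else 0 := fun i => by
    have := congrArg (Int.cast : ℤ → K) (hMN i k)
    push_cast at this
    exact this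
  simp only [hcast, mul_ite, mul_zero, Finset.sum_ite_eq', Finset.mem_univ, if_true,
    mul_eq_zero, Int.cast_eq_zero, hc, or_false] at h
  exact h

theorem edgePairWeight_natCast {V : Type*} [Fintype V] [DecidableEq V] (x y z : ℕ)
    (e f : (completeGraph V).edgeSet) :
    ((edgePairWeight x y z e f : ℕ) : ℤ) = edgePairWeight (x : ℤ) y z e f := by
  unfold edgePairWeight
  split_ifs <;> rfl

/-- The Hessian of the Kirchhoff polynomial of `K₄` or `K₅` at `(1, …, 1)` is nondegenerate. -/
theorem hessian_kirchhoffPolynomial_nondegenerate {K : Type*} [Field K] [CharZero K] {n : ℕ}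
    (h4 : 4 ≤ n) (h5 : n ≤ 5) {p : (completeGraph (Fin n)).edgeSet → K}
    (hp : ∀ f, ∑ e, p e * eval (fun _ => (1 : K))
      (pderiv f (pderiv e (kirchhoffPolynomial K (completeGraph (Fin n))))) = 0) : p = 0 := by
  simp only [eval_one_pderiv_pderiv_kirchhoffPolynomial] at hp
  obtain rfl | rfl : n = 4 ∨ n = 5 := by omega
  · simp only [spanningTreeCount_four] at hp
    exact eq_zero_of_sum_mul_eq_zero (c := 32) (by norm_num)
      (fun e g => by simpa only [edgePairWeight_natCast] using! sum_edgePairWeight_mul_four e g) hp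
  · simp only [spanningTreeCount_five] at hp
    exact eq_zero_of_sum_mul_eq_zero (c := 750) (by norm_num)
      (fun e g => by simpa only [edgePairWeight_natCast] using! sum_edgePairWeight_mul_five e g) hp

theorem mainTheorem5 (K : Type*) [Field K] [CharZero K] (n : ℕ) (hn : 1 ≤ n) (hn5 : n ≤ 5) :
    IsArtinianGorenstein (GraphicAlgebra K (SimpleGraph.completeGraph (Fin n))) ∧
    IsGradedArtinian (graphicGrading K (SimpleGraph.completeGraph (Fin n))) (n - 1) ∧
    HasStrongLefschetzProperty (graphicGrading K (SimpleGraph.completeGraph (Fin n))) ∧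
    IsStrongLefschetzElement (graphicGrading K (SimpleGraph.completeGraph (Fin n))) (n - 1)
      (edgeSum K (SimpleGraph.completeGraph (Fin n))) := by
  have : Nonempty (Fin n) := ⟨⟨0, hn⟩⟩
  have hF : (kirchhoffPolynomial K (completeGraph (Fin n))).IsHomogeneous (n - 1) := by
    simpa using kirchhoffPolynomial_isHomogeneous (K := K) (G := completeGraph (Fin n))
  have h1 : eval (fun _ => (1 : K)) (kirchhoffPolynomial K (completeGraph (Fin n))) ≠ 0 :=
    eval_one_kirchhoffPolynomial_ne_zero connected_top
  have h0 : kirchhoffPolynomial K (completeGraph (Fin n)) ≠ 0 := by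
    intro h
    rw [h, map_zero] at h1
    exact h1 rfl
  have hgr := isGradedArtinian_apolarAlgebra hF h0
  have hL : IsStrongLefschetzElement (graphicGrading K (completeGraph (Fin n))) (n - 1)
      (edgeSum K (completeGraph (Fin n))) := by
    -- The Hessian is needed only when n - 1 ≥ 3, that is, for n = 4 and n = 5.
    have h := isStrongLefschetzElement_sum_X hF (by omega) h1 fun h3 _ hp =>
      hessian_kirchhoffPolynomial_nondegenerate (by omega) hn5 hp
    convert! h using 1
    unfold edgeSum
    congr!
  exact ⟨isArtinianGorenstein_apolarAlgebra hF h0, hgr, ⟨_, hgr, _, hL⟩, hL⟩
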